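/- Let $\mathbb F_q$ be a finite field, let $\ell$, $m_1\ge\dots\ge m_\ell$ and $n_1,\dots,n_\ell$ be positive integers with $n_i\le m_i$ for all $i$, and put $n=n_1+\dots+n_\ell$ and $\mathbb M=\mathbb F_q^{m_1\times n_1}\times\dots\times\mathbb F_q^{m_\ell\times n_\ell}$. A code is an $\mathbb F_q$-linear subspace $\mathcal C\subseteq\mathbb M$. For $C=(C_1,\dots,C_\ell)\in\mathbb M$ let $\mathrm{srk}(C)=\sum_{i=1}^\ell\mathrm{rk}(C_i)$; let $\mathrm{maxsrk}(\mathcal C)=\max\{\mathrm{srk}(C): C\in\mathcal C\}$ and, if $\mathcal C\neq0$, $d(\mathcal C)=\min\{\mathrm{srk}(C): 0\ne C\in\mathcal C\}$. A subspace $\mathcal A_i\subseteq\mathbb F_q^{m_i\times n_i}$ is an optimal anticode if $\dim\mathcal A_i=\max\{m_i\,\mathrm{rk}(A): A\in\mathcal A_i\}$. Let $\mathbb A$ be the set of all codes $\mathcal A=\mathcal A_1\times\dots\times\mathcal A_\ell$ with every $\mathcal A_i\subseteq\mathbb F_q^{m_i\times n_i}$ an optimal anticode. For $1\le r\le\dim\mathcal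 C$ the $r$-th generalized sum-rank weight of $\mathcal C$ is $$d_r(\mathcal C)=\min\{\mathrm{maxsrk}(\mathcal A):\mathcal A\in\mathbb A,\ \dim(\mathcal C\cap\mathcal A)\ge r\},$$ and for $0\le\mu\le n$ put $r_\mu=\max\{\dim\mathcal A:\mathcal A\in\mathbb A,\ \mathrm{maxsrk}(\mathcal A)=\mu\}$ (so $r_0=0$). A code $\mathcal C$ is MSRD if there are $j\in\{1,\dots,\ell\}$ and $0\le\delta\le n_j-1$ with $$d(\mathcal C)=\sum_{i=1}^{j-1}n_i+\delta+1\quad\text{and}\quad\dim\mathcal C=\sum_{i=j}^{\ell}m_in_i-\delta m_j.$$ Theorem. Let $\mathcal C\subseteq\mathbb M$ be an MSRD code. Let $d(\mathcal C)\le h\le n$, let $k=\max\{\nu:\sum_{i=1}^{\nu-1}n_i<h\}$, and let $r=r_h-r_{d(\mathcal C)-1}-m_k+1$. Then $1\le r$ and $r+m_k-1\le\dim\mathcal C$, and $$d_r(\mathcal C)=d_{r+1}(\mathcal C)=\dots=d_{r+m_k-1}(\mathcal C)=h.$$ Moreover, every $s\in\{1,\dots,\dim\mathcal C\}$ satisfies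 $r\le s\le r+m_k-1$ for some such $h$, with the corresponding $k$ and $r$; hence all generalized sum-rank weights of $\mathcal C$ are determined by $d(\mathcal C)$, the $m_i$ and the $n_i$. -/

import Mathlib

namespace SumRank

open Module

/-- The ambient space `F^{m₁ × n₁} × ⋯ × F^{m_ℓ × n_ℓ}`. -/
abbrev Space (F : Type*) {ℓ : ℕ} (m n : Fin ℓ → ℕ) : Type _ :=
  ∀ i : Fin ℓ, Matrix (Fin (m i)) (Fin (n i)) F

/-- A (linear sum-rank metric) code. -/
abbrev Code (F : Type*) [Field F] {ℓ : ℕ} (m n : Fin ℓ → ℕ) : Type _ :=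
  Submodule F (Space F m n)

section
variable {F : Type*} [Field F] {ℓ : ℕ} {m n : Fin ℓ → ℕ}

/-- The sum-rank weight. -/
noncomputable def srk (C : Space F m n) : ℕ := ∑ i, (C i).rank

/-- The minimum distance, for a nonzero code. -/
noncomputable def minDist (C : Code F m n) : ℕ :=
  sInf {w | ∃ x ∈ C, x ≠ 0 ∧ srk x = w}

/-- The maximum sum-rank distance (the set is nonempty and bounded by `∑ i, n i`). -/
noncomputable def maxSrk (C : Code F m n) : ℕ :=
  sSup {w | ∃ x ∈ C, srk x = w}

/-- A linear space `A` of `a × b` matrices is an optimal (rank-metric) anticode if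
`dim A = max {a * rank M : M ∈ A}`. -/
def IsOptimalAnticode {a b : ℕ} (A : Submodule F (Matrix (Fin a) (Fin b) F)) : Prop :=
  IsGreatest {w | ∃ M ∈ A, a * M.rank = w} (finrank F A)

/-- The code `A₁ × ⋯ × A_ℓ`. -/
def prodCode (A : ∀ i : Fin ℓ, Submodule F (Matrix (Fin (m i)) (Fin (n i)) F)) : Code F m n :=
  Submodule.pi Set.univ A

/-- The products of optimal rank-metric anticodes, one in each block. -/
def IsProductAnticode (A : Code F m n) : Prop :=
  ∃ B : ∀ i : Fin ℓ, Submodule F (Matrix (Fin (m i)) (Fin (n i)) F),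
    (∀ i, IsOptimalAnticode (B i)) ∧ A = prodCode B

/-- The `r`-th generalized sum-rank weight, for `1 ≤ r ≤ dim C`. -/
noncomputable def genWeight (r : ℕ) (C : Code F m n) : ℕ :=
  sInf {w | ∃ A : Code F m n,
    IsProductAnticode A ∧ r ≤ finrank F (C ⊓ A : Code F m n) ∧ maxSrk A = w}

/-- The number `r_μ`: the largest dimension of a product of optimal anticodes whose maximum
sum-rank distance is `μ`, for `0 ≤ μ ≤ n₁ + ⋯ + n_ℓ` (so `r_0 = 0`). -/
noncomputable def maxAnticodeDim (F : Type*) [Field F] {ℓ : ℕ} (m n : Fin ℓ → ℕ) (μ : ℕ) : ℕ :=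
  sSup {w | ∃ A : Code F m n, IsProductAnticode A ∧ maxSrk A = μ ∧ finrank F A = w}

/-- A code is MSRD if, for some block `j` and some `0 ≤ δ ≤ n_j - 1`,
`d(C) = ∑_{i<j} n_i + δ + 1` and `dim C = ∑_{i≥j} m_i n_i - δ m_j`. -/
def IsMSRD (C : Code F m n) : Prop :=
  ∃ (j : Fin ℓ) (δ : ℕ), δ < n j ∧
    minDist C = ∑ i ∈ Finset.Iio j, n i + δ + 1 ∧
    finrank F C + δ * m j = ∑ i ∈ Finset.Ici j, m i * n i

/-- `k` is the block containing position `h`: `k = max {ν : ∑_{i<ν} n_i < h}`. -/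
def IsBlockOf (n : Fin ℓ → ℕ) (h : ℕ) (k : Fin ℓ) : Prop :=
  IsGreatest {ν : Fin ℓ | ∑ i ∈ Finset.Iio ν, n i < h} k

end

end SumRank

/-!
The proof rests on the structure of optimal anticodes and on a count of dimensions.

Let `R h` be the number of matrix entries in the first `h` columns of the whole space
(`fillDim m n h`). Since `m` is antitone, `R h` is the largest dimension of a product of optimal
anticodes of maximum sum-rank `h` (`maxAnticodeDim_eq`), and `R h = R (h - 1) + m k` if column `h`
lies in block `k` (`fillDim_succ`). An MSRD code `C` with minimum distance `d` has dimension
`R N - R (d - 1)`, where `N` is the number of all columns. The theorem therefore says that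
`d_s(C) = h` whenever `R (h - 1) < s + R (d - 1) ≤ R h` (`IsMSRD.genWeight_eq`). The bound
`d_s(C) ≤ h` is the dimension formula for the intersection of `C` with a product of dimension `R h`.

For the lower bound, let `A` be a product of optimal anticodes with maximum ranks `u i` in its
blocks, and let `μ = ∑ u i`. If `A` contains a subspace `B` of dimension `∑ m i * v i` whose
sum-rank weights are at most `∑ v i = d - 1`, then `C ∩ B = 0`, hence
`dim (C ∩ A) ≤ ∑ m i * (u i - v i)`, and for a suitable `v ≤ u` the right-hand side is at most
`R μ - R (d - 1)` (`exists_le_sum_eq`). Such a `B` exists for every `v ≤ u` because each optimal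
anticode contains optimal anticodes of all smaller maximum ranks (`exists_subanticode`).

This last fact follows from the classification of the optimal anticodes `A` in `Hom(V, W)`, where
`dim V ≤ dim W`, over a finite field: they consist of all maps vanishing on a subspace of `V` or, if
`dim V = dim W`, of all maps with values in a subspace of `W` (`eq_vanishingOn_or_eq_valuedIn`). If
`A` has ranks at most `u`, then in any pair of bases its leading positions, taken column by column,
meet each injection from columns to rows in at most `u` cells (`card_isPivot_le`). The cyclic
shifts of an injection partition the board, so `dim A = u * dim W` forces each injection to be met
exactly `u` times, and thus the leading positions fill whole columns, or whole rows of a square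
board. If they fill columns for all bases, then the values of `A` at each vector are `0` or all of
`W`, and counting the pairs of `M ∈ A` and `x ∈ V` with `M x = 0` yields a common kernel of the
right dimension (`exists_eq_vanishingOn`). If they fill rows for some basis beginning with `x`, then
`A` contains all maps into `U = A x` that vanish at `x`, and adding such maps to one with a value
outside `U` would produce too large a rank (`eq_valuedIn`).
-/

namespace SumRank
open Module

/-! ### Linear independence and bases -/

section Pivots
variable {F V W : Type*} [Field F] [AddCommGroup V] [Module F V] [AddCommGroup W] [Module F W]

lemma linearIndepOn_update_or_update_add {ι : Type*} [DecidableEq ι] {s : Set ι} {v : ι → W}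
    (hv : LinearIndepOn F v s) {t : ι} (ht : t ∈ s) (z : W) :
    LinearIndepOn F (Function.update v t z) s ∨
      LinearIndepOn F (Function.update v t (z + v t)) s := by
  have hs : insert t (s \ {t}) = s := by simp [ht]
  have key : ∀ y : W, LinearIndepOn F (Function.update v t y) s ↔
      y ∉ Submodule.span F (v '' (s \ {t})) := by
    intro y
    have himg : Function.update v t y '' (s \ {t}) = v '' (s \ {t}) :=
      Set.image_congr fun j hj => by simp [Function.update_of_ne hj.2]
    have hrest : LinearIndepOn F (Function.update v t y) (s \ {t}) :=
      (linearIndepOn_congr fun j hj => by simp [Function.update_of_ne hj.2]).2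
        (hv.mono Set.sdiff_subset)
    conv_lhs => rw [← hs]
    rw [linearIndepOn_insert (by simp), himg]
    simp [hrest]
  have hvt : v t ∉ Submodule.span F (v '' (s \ {t})) := by
    simpa using (key (v t)).1 (by simpa using hv)
  by_contra! hcon
  simp only [key, not_not] at hcon
  exact hvt (by simpa using Submodule.sub_mem _ hcon.2 hcon.1)

/-- A linearly independent family indexed by `Fin k` is the beginning of a basis. -/
lemma exists_basis_castLE [FiniteDimensional F V] {k n : ℕ} (hn : finrank F V = n) {v : Fin k → V}
    (hv : LinearIndependent F v) (hk : k ≤ n) :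
    ∃ b : Basis (Fin n) F V, ∀ i : Fin k, b (Fin.castLE hk i) = v i := by
  obtain ⟨d, rfl⟩ := Nat.exists_eq_add_of_le hk
  induction d generalizing k with
  | zero =>
    refine ⟨basisOfLinearIndependentOfCardEqFinrank' _ hv (by simpa using hn.symm), fun i => ?_⟩
    simp
  | succ d ih =>
    obtain ⟨x, hx⟩ := exists_linearIndependent_snoc_of_lt_finrank hv (by omega)
    have e : k + 1 + d = k + (d + 1) := by omega
    obtain ⟨b, hb⟩ := ih hx (by omega) (by omega)
    refine ⟨b.reindex (finCongr e), fun i => ?_⟩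
    have := hb i.castSucc
    rw [Fin.snoc_castSucc] at this
    rw [← this]
    simp [Basis.reindex_apply]

/-! ### Leading positions of a space of linear maps -/

/-- The last nonzero coordinate of `w` in the basis `c` is the one of index `i`. -/
def IsLead {m : ℕ} (c : Basis (Fin m) F W) (w : W) (i : Fin m) : Prop :=
  c.repr w i ≠ 0 ∧ ∀ i', i < i' → c.repr w i' = 0

lemma exists_isLead {m : ℕ} (c : Basis (Fin m) F W) {w : W} (hw : w ≠ 0) :
    ∃ i, IsLead c w i := by
  classical
  have hne : (Finset.univ.filter fun i => c.repr w i ≠ 0).Nonempty := by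
    by_contra hcon
    rw [Finset.not_nonempty_iff_eq_empty, Finset.filter_eq_empty_iff] at hcon
    apply hw
    apply c.repr.injective
    ext i
    simpa using hcon (Finset.mem_univ i)
  refine ⟨_, (Finset.mem_filter.1 (Finset.max'_mem _ hne)).2, fun i' hi' => ?_⟩
  by_contra hcon
  exact absurd (Finset.le_max' _ i' (by simp [hcon])) (not_le.2 hi')

lemma linearIndependent_of_isLead {ι : Type*} {m : ℕ} (c : Basis (Fin m) F W) {v : ι → W}
    {σ : ι → Fin m} (hσ : Function.Injective σ) (h : ∀ i, IsLead c (v i) (σ i)) :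
    LinearIndependent F v := by
  classical
  refine linearIndependent_iff'.2 fun s g hg => ?_
  by_contra! hcon
  obtain ⟨i₀, hi₀, hgi₀⟩ := hcon
  obtain ⟨i, hi, hmax⟩ := Finset.exists_max_image (s.filter fun i => g i ≠ 0) σ
    ⟨i₀, by simp [hi₀, hgi₀]⟩
  rw [Finset.mem_filter] at hi
  have h0 := congrArg (fun w => c.repr w (σ i)) hg
  simp only [map_sum, map_smul, Finsupp.coe_finsetSum, Finset.sum_apply, Finsupp.smul_apply,
    smul_eq_mul, map_zero, Finsupp.zero_apply] at h0
  rw [Finset.sum_eq_single_of_mem i hi.1] at h0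
  · exact mul_ne_zero hi.2 (h i).1 h0
  · intro j hj hji
    by_cases hgj : g j = 0
    · simp [hgj]
    · have := lt_of_le_of_ne (hmax j (by simp [hj, hgj])) (hσ.ne hji)
      simp [(h j).2 _ this]

/-- `(j, i)` is a leading position of the space `A` of linear maps: in the bases `b` and `c`, the
first nonzero column of some matrix of `A` is column `j`, and its last nonzero entry is in
row `i`. -/
def IsPivot {n m : ℕ} (A : Submodule F (V →ₗ[F] W)) (b : Basis (Fin n) F V)
    (c : Basis (Fin m) F W) (j : Fin n) (i : Fin m) : Prop :=
  ∃ M ∈ A, (∀ j' < j, M (b j') = 0) ∧ IsLead c (M (b j)) i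

open Classical in
lemma finrank_le_card_isPivot {n m : ℕ} (A : Submodule F (V →ₗ[F] W)) (b : Basis (Fin n) F V)
    (c : Basis (Fin m) F W) :
    finrank F A ≤ (Finset.univ.filter fun p : Fin n × Fin m => IsPivot A b c p.1 p.2).card := by
  let f : A →ₗ[F] ({p : Fin n × Fin m // IsPivot A b c p.1 p.2} → F) :=
    LinearMap.pi fun p => (c.coord p.1.2) ∘ₗ (LinearMap.applyₗ (b p.1.1)) ∘ₗ A.subtype
  have hf : Function.Injective f := by
    rw [injective_iff_map_eq_zero]
    rintro ⟨M, hM⟩ h0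
    by_contra hne
    have hne : M ≠ 0 := fun h => hne (by simp [h])
    have hex : (Finset.univ.filter fun j => M (b j) ≠ 0).Nonempty := by
      by_contra hcon
      rw [Finset.not_nonempty_iff_eq_empty, Finset.filter_eq_empty_iff] at hcon
      exact hne (b.ext fun j => by simpa using hcon (Finset.mem_univ j))
    set j := Finset.min' _ hex with hj
    have hMj : M (b j) ≠ 0 := (Finset.mem_filter.1 (Finset.min'_mem _ hex)).2
    obtain ⟨i, hi⟩ := exists_isLead c hMj
    have hlt : ∀ j' < j, M (b j') = 0 := fun j' hj' => by
      by_contra hcon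
      exact absurd (Finset.min'_le _ j' (by simp [hcon])) (not_le.2 hj')
    exact hi.1 (congrFun h0 ⟨(j, i), M, hM, hlt, hi⟩)
  have := LinearMap.finrank_le_finrank_of_injective hf
  rwa [finrank_fintype_fun_eq_card, Fintype.card_subtype] at this

/-- If maps `M j ∈ A`, for `j ∈ J`, vanish on the basis vectors before the `j`-th one and send the
`j`-th ones to linearly independent vectors, then `A` contains a single map sending all `b j`,
`j ∈ J`, to linearly independent vectors. A combination of the `M j` with coefficients `0`
and `1` does it, so that the size of the field does not matter. -/
lemma exists_mem_linearIndepOn {n : ℕ} {A : Submodule F (V →ₗ[F] W)} {b : Basis (Fin n) F V}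
    {J : Set (Fin n)} {M : Fin n → V →ₗ[F] W} (hM : ∀ j ∈ J, M j ∈ A)
    (hlt : ∀ j ∈ J, ∀ j' < j, M j (b j') = 0) (hJ : LinearIndepOn F (fun j => M j (b j)) J) :
    ∃ N ∈ A, LinearIndepOn F (fun j => N (b j)) J := by
  classical
  have key : ∀ t ≤ n, ∃ N ∈ A,
      LinearIndepOn F (fun j : Fin n => if j.1 < t then N (b j) else M j (b j)) J := by
    intro t
    induction t with
    | zero => exact fun _ => ⟨0, A.zero_mem, by simpa using hJ⟩
    | succ t ih =>
      intro ht
      obtain ⟨N, hN, hli⟩ := ih (by omega)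
      let k : Fin n := ⟨t, ht⟩
      by_cases hk : k ∈ J
      · have hupd : ∀ N' : V →ₗ[F] W, (∀ j < k, N' (b j) = N (b j)) →
            (fun j : Fin n => if j.1 < t + 1 then N' (b j) else M j (b j)) =
            Function.update (fun j : Fin n => if j.1 < t then N (b j) else M j (b j)) k
              (N' (b k)) := by
          intro N' hN'
          funext j
          rcases lt_trichotomy j k with h | h | h
          · have h' : j.1 < t := h
            rw [Function.update_of_ne h.ne, if_pos (by omega), if_pos h', hN' j h]
          · subst h
            simp [k]
          · have h' : t < j.1 := h
            rw [Function.update_of_ne h.ne', if_neg (by omega), if_neg (by omega)]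
        rcases linearIndepOn_update_or_update_add hli hk (N (b k)) with h | h
        · exact ⟨N, hN, by rwa [hupd N fun _ _ => rfl]⟩
        · refine ⟨N + M k, A.add_mem hN (hM k hk), ?_⟩
          rw [hupd _ fun j hj => by simp [hlt k hk j hj]]
          simpa [k] using h
      · refine ⟨N, hN, (linearIndepOn_congr fun j hj => ?_).2 hli⟩
        have : j.1 ≠ t := fun h => hk (by rwa [show k = j from Fin.ext h.symm])
        by_cases h : j.1 < t
        · simp [h, show j.1 < t + 1 by omega]
        · simp [h, show ¬ j.1 < t + 1 by omega]
  obtain ⟨N, hN, h⟩ := key n le_rfl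
  exact ⟨N, hN, by simpa using h⟩

open Classical in
/-- Leading positions in distinct rows and columns are at most as many as the largest rank. -/
lemma card_isPivot_le {n m u : ℕ} [FiniteDimensional F W] {A : Submodule F (V →ₗ[F] W)}
    (hA : ∀ M ∈ A, finrank F (LinearMap.range M) ≤ u) (b : Basis (Fin n) F V)
    (c : Basis (Fin m) F W) {σ : Fin n → Fin m} (hσ : Function.Injective σ) :
    (Finset.univ.filter fun j => IsPivot A b c j (σ j)).card ≤ u := by
  set J := Finset.univ.filter fun j => IsPivot A b c j (σ j) with hJ
  have hex : ∀ j, ∃ M : V →ₗ[F] W, j ∈ J →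
      M ∈ A ∧ (∀ j' < j, M (b j') = 0) ∧ IsLead c (M (b j)) (σ j) := by
    intro j
    by_cases hj : j ∈ J
    · obtain ⟨M, h⟩ := (Finset.mem_filter.1 hj).2
      exact ⟨M, fun _ => h⟩
    · exact ⟨0, fun h => absurd h hj⟩
  choose M hM using hex
  have hli : LinearIndepOn F (fun j => M j (b j)) (J : Set (Fin n)) :=
    linearIndependent_of_isLead c (σ := fun j : (J : Set (Fin n)) => σ j)
      (hσ.comp Subtype.val_injective) fun j => (hM j j.2).2.2
  obtain ⟨N, hN, hli⟩ := exists_mem_linearIndepOn (A := A) (fun j hj => (hM j hj).1)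
    (fun j hj => (hM j hj).2.1) hli
  have hr : LinearIndependent F fun j : J => (⟨N (b j), b j, rfl⟩ : LinearMap.range N) :=
    LinearIndependent.of_comp (LinearMap.range N).subtype hli
  have := hr.fintype_card_le_finrank
  rw [Fintype.card_coe] at this
  exact this.trans (hA N hN)

end Pivots

/-! ### Cell sets met equally by all injections -/

section Cells
open Classical

lemma sum_card_cells_shift {n m : ℕ} [NeZero m] (P : Fin n → Fin m → Prop) (σ : Fin n → Fin m) :
    ∑ t : Fin m, (Finset.univ.filter fun j => P j (σ j + t)).card =
      (Finset.univ.filter fun p : Fin n × Fin m => P p.1 p.2).card := by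
  simp only [Finset.card_filter]
  rw [Finset.sum_comm, Fintype.sum_prod_type]
  exact Finset.sum_congr rfl fun j _ =>
    Equiv.sum_comp (Equiv.addLeft (σ j)) fun i => if P j i then 1 else 0

lemma card_cells_shift_le {n m u : ℕ} [NeZero m] {P : Fin n → Fin m → Prop}
    (hle : ∀ σ : Fin n → Fin m, Function.Injective σ →
      (Finset.univ.filter fun j => P j (σ j)).card ≤ u)
    {σ : Fin n → Fin m} (hσ : Function.Injective σ) (t : Fin m) :
    (Finset.univ.filter fun j => P j (σ j + t)).card ≤ u :=
  hle (fun j => σ j + t) fun _ _ h => hσ (add_right_cancel h)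

/-- The cyclic shifts of an injection `Fin n → Fin m` partition the board, so a set of cells that
meets every injection in at most `u` cells has at most `m * u` cells. -/
lemma card_cells_le {n m u : ℕ} (hm : 0 < m) (hnm : n ≤ m) {P : Fin n → Fin m → Prop}
    (hle : ∀ σ : Fin n → Fin m, Function.Injective σ →
      (Finset.univ.filter fun j => P j (σ j)).card ≤ u) :
    (Finset.univ.filter fun p : Fin n × Fin m => P p.1 p.2).card ≤ m * u := by
  have : NeZero m := ⟨hm.ne'⟩
  rw [← sum_card_cells_shift P (Fin.castLE hnm)]
  simpa using Finset.sum_le_sum fun t (_ : t ∈ Finset.univ) =>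
    card_cells_shift_le hle (Fin.castLE_injective hnm) t

/-- In the equality case of `card_cells_le` every injection is met in exactly `u` cells. -/
lemma card_cells_eq {n m u : ℕ} (hm : 0 < m) {P : Fin n → Fin m → Prop}
    (hP : m * u ≤ (Finset.univ.filter fun p : Fin n × Fin m => P p.1 p.2).card)
    (hle : ∀ σ : Fin n → Fin m, Function.Injective σ →
      (Finset.univ.filter fun j => P j (σ j)).card ≤ u)
    {σ : Fin n → Fin m} (hσ : Function.Injective σ) :
    (Finset.univ.filter fun j => P j (σ j)).card = u := by
  have : NeZero m := ⟨hm.ne'⟩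
  have hshift := card_cells_shift_le hle hσ
  have heq : ∑ t : Fin m, (Finset.univ.filter fun j => P j (σ j + t)).card = ∑ _t : Fin m, u :=
    le_antisymm (Finset.sum_le_sum fun t _ => hshift t)
      (by simpa [sum_card_cells_shift] using hP)
  have := (Finset.sum_eq_sum_iff_of_le fun t _ => hshift t).1 heq 0 (Finset.mem_univ _)
  simpa using this

lemma exists_perm_pair {α : Type*} {a b i k : α} (hab : a ≠ b) (hik : i ≠ k) :
    ∃ π : Equiv.Perm α, π a = i ∧ π b = k := by
  refine ⟨(Equiv.swap (Equiv.swap a i b) k) * Equiv.swap a i, ?_, ?_⟩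
  · have : i ≠ Equiv.swap a i b := fun h => hab (by
      have := congrArg (Equiv.swap a i) h
      simpa using this)
    simp [Equiv.swap_apply_of_ne_of_ne this hik]
  · simp

/-- A set of cells meeting all injections equally consists of full columns when `n < m`: compare
two injections that differ in one value. -/
lemma cells_column_of_lt {n m u : ℕ} (hnm : n < m) {P : Fin n → Fin m → Prop}
    (h : ∀ σ : Fin n → Fin m, Function.Injective σ →
      (Finset.univ.filter fun j => P j (σ j)).card = u) (j : Fin n) (i i' : Fin m) :
    P j i ↔ P j i' := by
  rcases eq_or_ne i i' with rfl | hi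
  · rfl
  obtain ⟨π, h1, h2⟩ := exists_perm_pair (a := Fin.castLE hnm.le j) (b := ⟨n, hnm⟩)
    (fun h => by have := congrArg Fin.val h; simp at this; omega) hi
  let σ : Fin n → Fin m := fun j => π (Fin.castLE hnm.le j)
  have hσ : Function.Injective σ := π.injective.comp (Fin.castLE_injective _)
  have hσ' : Function.Injective (Function.update σ j i') := by
    have hne : ∀ x, σ x ≠ i' := fun x hx => by
      rw [← h2] at hx
      have := congrArg Fin.val (π.injective hx)
      simp at this
      omega
    intro x y hxy
    by_cases hx : x = j <;> by_cases hy : y = j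
    · rw [hx, hy]
    · subst hx
      simp [hy] at hxy
      exact absurd hxy.symm (hne y)
    · subst hy
      simp [hx] at hxy
      exact absurd hxy (hne x)
    · simp [hx, hy] at hxy
      exact hσ hxy
  have e := (h _ hσ).trans (h _ hσ').symm
  simp only [Finset.card_filter] at e
  rw [← Finset.add_sum_erase _ _ (Finset.mem_univ j),
    ← Finset.add_sum_erase Finset.univ (fun x => if P x (Function.update σ j i' x) then 1 else 0)
      (Finset.mem_univ j)] at e
  rw [Finset.sum_congr (g := fun x => if P x (σ x) then 1 else 0) rfl
    (f := fun x => if P x (Function.update σ j i' x) then 1 else 0) fun x hx => by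
      rw [Function.update_of_ne (Finset.ne_of_mem_erase hx)]] at e
  simp only [show σ j = i from h1, Function.update_self, add_left_inj] at e
  split_ifs at e <;> simp_all

/-- A set of cells of a square board meeting all permutations equally consists of full columns or
of full rows: compare two permutations that differ by a transposition. -/
lemma cells_column_or_row {n u : ℕ} {P : Fin n → Fin n → Prop}
    (h : ∀ σ : Fin n → Fin n, Function.Injective σ →
      (Finset.univ.filter fun j => P j (σ j)).card = u) :
    (∀ j i i', P j i ↔ P j i') ∨ (∀ j j' i, P j i ↔ P j' i) := by
  have key : ∀ j j' i i', j ≠ j' → i ≠ i' →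
      (if P j i then 1 else 0) + (if P j' i' then 1 else 0) =
        (if P j i' then 1 else 0) + (if P j' i then 1 else 0) := by
    intro j j' i i' hj hi
    obtain ⟨π, h1, h2⟩ := exists_perm_pair hj hi
    have e := (h _ π.injective).trans (h _ (π * Equiv.swap j j').injective).symm
    simp only [Finset.card_filter] at e
    have hj' : j' ∈ Finset.univ.erase j := by simp [hj.symm]
    rw [← Finset.add_sum_erase _ _ (Finset.mem_univ j), ← Finset.add_sum_erase _ _ hj',
      ← Finset.add_sum_erase Finset.univ (fun x => if P x ((π * Equiv.swap j j') x) then 1 else 0)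
        (Finset.mem_univ j),
      ← Finset.add_sum_erase _ (fun x => if P x ((π * Equiv.swap j j') x) then 1 else 0) hj'] at e
    rw [Finset.sum_congr (g := fun x => if P x ((π * Equiv.swap j j') x) then 1 else 0) rfl
      fun x hx => by
        rw [Equiv.Perm.mul_apply, Equiv.swap_apply_of_ne_of_ne
          (Finset.ne_of_mem_erase (Finset.mem_of_mem_erase hx)) (Finset.ne_of_mem_erase hx)]] at e
    simp only [Equiv.Perm.mul_apply, Equiv.swap_apply_left, Equiv.swap_apply_right, h1, h2,
      ← add_assoc, add_left_inj] at e
    exact e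
  by_contra! hcon
  obtain ⟨⟨j, i, i', h1⟩, k, k', r, h2⟩ := hcon
  have aux : ∀ j i i', P j i → ¬ P j i' → False := by
    intro j i i' hi hi'
    have hii' : i ≠ i' := fun h => hi' (h ▸ hi)
    have hall : ∀ j', P j' i ∧ ¬ P j' i' := by
      intro j'
      rcases eq_or_ne j j' with rfl | hj
      · exact ⟨hi, hi'⟩
      · have := key j j' i i' hj hii'
        simp only [hi, hi', if_true, if_false] at this
        split_ifs at this <;> simp_all
    have hall' : ∀ k k', P k r → P k' r := by
      intro k k' hr
      rcases eq_or_ne k k' with rfl | hk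
      · exact hr
      have := key k k' r i' hk (fun h => (hall k).2 (h ▸ hr))
      simp only [hr, (hall k).2, (hall k').2, if_true, if_false] at this
      split_ifs at this <;> simp_all
    rcases h2 with h2 | h2
    · exact h2.2 (hall' _ _ h2.1)
    · exact h2.1 (hall' _ _ h2.2)
  rcases h1 with h1 | h1
  · exact aux _ _ _ h1.1 h1.2
  · exact aux _ _ _ h1.2 h1.1

end Cells

/-! ### Spaces of linear maps cut out by a kernel or a range condition -/

section Classification
variable {F V W : Type*} [Field F] [AddCommGroup V] [Module F V] [AddCommGroup W] [Module F W]

/-- The space of linear maps vanishing on `K`. -/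
def vanishingOn (W : Type*) [AddCommGroup W] [Module F W] (K : Submodule F V) :
    Submodule F (V →ₗ[F] W) :=
  LinearMap.range (LinearMap.lcomp F W K.mkQ)

/-- The space of linear maps with values in `U`. -/
def valuedIn (V : Type*) [AddCommGroup V] [Module F V] (U : Submodule F W) :
    Submodule F (V →ₗ[F] W) :=
  LinearMap.range (LinearMap.compRight F (M := V) U.subtype)

lemma mem_vanishingOn {K : Submodule F V} {M : V →ₗ[F] W} :
    M ∈ vanishingOn W K ↔ K ≤ LinearMap.ker M := by
  constructor
  · rintro ⟨g, rfl⟩ x hx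
    change g (K.mkQ x) = 0
    rw [(LinearMap.mem_ker (f := K.mkQ)).1 (by simpa using hx), map_zero]
  · intro h
    exact ⟨K.liftQ M h, by ext x; simp⟩

lemma mem_valuedIn {U : Submodule F W} {M : V →ₗ[F] W} :
    M ∈ valuedIn V U ↔ ∀ x, M x ∈ U := by
  constructor
  · rintro ⟨g, rfl⟩ x
    simp
  · intro h
    exact ⟨M.codRestrict U h, by ext x; simp⟩

lemma injective_compRight_subtype (U : Submodule F W) :
    Function.Injective (LinearMap.compRight F (M := V) U.subtype) := fun f g h => by
  ext x
  simpa using LinearMap.congr_fun h x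

/-- The values at `x` of the maps in `A`. -/
def valuesAt (A : Submodule F (V →ₗ[F] W)) (x : V) : Submodule F W :=
  A.map (LinearMap.applyₗ x)

lemma mem_valuesAt {A : Submodule F (V →ₗ[F] W)} {x : V} {w : W} :
    w ∈ valuesAt A x ↔ ∃ M ∈ A, M x = w := by
  simp [valuesAt]

variable [FiniteDimensional F V]

lemma finrank_range_le_of_mem_vanishingOn {K : Submodule F V} {M : V →ₗ[F] W}
    (hM : M ∈ vanishingOn W K) :
    finrank F (LinearMap.range M) ≤ finrank F V - finrank F K := by
  have h1 := Submodule.finrank_mono (mem_vanishingOn.1 hM)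
  have h2 := M.finrank_range_add_finrank_ker
  omega

variable [FiniteDimensional F W]

lemma finrank_vanishingOn (K : Submodule F V) :
    finrank F (vanishingOn W K) = (finrank F V - finrank F K) * finrank F W := by
  rw [vanishingOn, LinearMap.finrank_range_of_inj, Module.finrank_linearMap,
    Submodule.finrank_quotient]
  intro f g h
  ext x
  simpa using LinearMap.congr_fun h x

lemma finrank_valuedIn (U : Submodule F W) :
    finrank F (valuedIn V U) = finrank F V * finrank F U := by
  rw [valuedIn, LinearMap.finrank_range_of_inj (injective_compRight_subtype U),
    Module.finrank_linearMap]

lemma finrank_vanishingOn_inf_valuedIn (K : Submodule F V) (U : Submodule F W) :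
    finrank F (vanishingOn W K ⊓ valuedIn V U : Submodule F (V →ₗ[F] W)) =
      (finrank F V - finrank F K) * finrank F U := by
  have : vanishingOn W K ⊓ valuedIn V U =
      (vanishingOn U K).map (LinearMap.compRight F (M := V) U.subtype) := by
    ext M
    simp only [Submodule.mem_inf, mem_vanishingOn, mem_valuedIn, Submodule.mem_map]
    constructor
    · rintro ⟨h1, h2⟩
      refine ⟨M.codRestrict U h2, fun x hx => ?_, by ext x; simp⟩
      have := h1 hx
      simpa [Subtype.ext_iff] using this
    · rintro ⟨g, h1, rfl⟩
      refine ⟨fun x hx => ?_, fun x => by simp⟩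
      have := h1 hx
      rw [LinearMap.mem_ker] at this ⊢
      simp [this]
  rw [this, ← (Submodule.equivMapOfInjective _ (injective_compRight_subtype U) _).finrank_eq,
    finrank_vanishingOn]

/-! ### Optimal anticodes of linear maps -/

/-- The anticode bound. -/
lemma finrank_le_of_rank_le {A : Submodule F (V →ₗ[F] W)} {u : ℕ}
    (hVW : finrank F V ≤ finrank F W)
    (hA : ∀ M ∈ A, finrank F (LinearMap.range M) ≤ u) :
    finrank F A ≤ finrank F W * u := by
  classical
  rcases Nat.eq_zero_or_pos (finrank F W) with hW | hW
  · have := Submodule.finrank_le A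
    rw [Module.finrank_linearMap, hW] at this
    simpa [hW] using this
  · exact (finrank_le_card_isPivot A (finBasis F V) (finBasis F W)).trans
      (card_cells_le hW hVW fun σ hσ => by
        convert card_isPivot_le hA (finBasis F V) (finBasis F W) hσ)

end Classification

section Classification
variable {F V W : Type*} [Field F] [AddCommGroup V] [Module F V] [AddCommGroup W] [Module F W]
  [FiniteDimensional F W]

open Classical in
lemma sum_ite_eq_zero [Finite F] {X Y : Type*} [AddCommGroup X] [Module F X] [AddCommGroup Y]
    [Module F Y] [FiniteDimensional F X] [Fintype X] (f : X →ₗ[F] Y) :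
    ∑ x, (if f x = 0 then 1 else 0) = Nat.card F ^ finrank F (LinearMap.ker f) := by
  rw [← Module.natCard_eq_pow_finrank (K := F) (V := LinearMap.ker f), ← Finset.card_filter,
    Nat.card_eq_fintype_card]
  exact (Fintype.card_subtype _).symm

/-- If the leading positions form full columns, the values of `A` at the first basis vector are
nothing but `0` or all of `W`. -/
lemma valuesAt_eq_bot_or_top {n m : ℕ} {A : Submodule F (V →ₗ[F] W)} {b : Basis (Fin n) F V}
    {c : Basis (Fin m) F W} (h : ∀ j i i', IsPivot A b c j i ↔ IsPivot A b c j i') (hn : 0 < n) :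
    valuesAt A (b ⟨0, hn⟩) = ⊥ ∨ valuesAt A (b ⟨0, hn⟩) = ⊤ := by
  set j₀ : Fin n := ⟨0, hn⟩
  by_cases hex : ∃ i, IsPivot A b c j₀ i
  · right
    obtain ⟨i₀, hi₀⟩ := hex
    choose M hM using fun i => (h j₀ i₀ i).1 hi₀
    have hli : LinearIndependent F fun i => M i (b j₀) :=
      linearIndependent_of_isLead c (σ := id) Function.injective_id fun i => (hM i).2.2
    have hspan := hli.span_eq_top_of_card_eq_finrank' (by simp [finrank_eq_card_basis c])
    rw [eq_top_iff, ← hspan, Submodule.span_le]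
    rintro _ ⟨i, rfl⟩
    exact mem_valuesAt.2 ⟨M i, (hM i).1, rfl⟩
  · left
    rw [eq_bot_iff]
    intro w hw
    obtain ⟨M, hM, rfl⟩ := mem_valuesAt.1 hw
    by_contra hne
    obtain ⟨i, hi⟩ := exists_isLead c (w := M (b j₀)) hne
    exact hex ⟨i, M, hM, fun j' hj' => absurd hj' (by simp [j₀, Fin.lt_def]), hi⟩

variable [FiniteDimensional F V]

/-- If the values of `A` at each vector are nothing but `0` or all of `W`, then an optimal anticode
`A` is the space of all maps vanishing on some subspace. The proof counts the pairs `(M, x)` with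
`M ∈ A` and `M x = 0` in two ways. -/
lemma exists_eq_vanishingOn [Finite F] {A : Submodule F (V →ₗ[F] W)} {u : ℕ}
    (hVW : finrank F V ≤ finrank F W) (hA : ∀ M ∈ A, finrank F (LinearMap.range M) ≤ u)
    (hdim : finrank F A = finrank F W * u)
    (hval : ∀ x, valuesAt A x = ⊥ ∨ valuesAt A x = ⊤) :
    ∃ K : Submodule F V, A = vanishingOn W K := by
  classical
  have : Finite V := Module.finite_of_finite F
  have : Finite A := Module.finite_of_finite F
  have : Fintype V := Fintype.ofFinite V
  have : Fintype A := Fintype.ofFinite A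
  set q := Nat.card F with hq
  have hq1 : 1 < q := Finite.one_lt_card
  set n := finrank F V
  set m := finrank F W
  -- the common kernel of the maps in `A`
  let K : Submodule F V := ⨅ M : A, LinearMap.ker M.1
  have hK : ∀ x, x ∈ K ↔ ∀ M ∈ A, M x = 0 := fun x => by simp [K]
  have hval' : ∀ x, x ∉ K → valuesAt A x = ⊤ := fun x hx =>
    (hval x).resolve_left fun h => hx <| (hK x).2 fun M hM => by
      have : M x ∈ valuesAt A x := mem_valuesAt.2 ⟨M, hM, rfl⟩
      simpa [h] using this
  have hAK : A ≤ vanishingOn W K := fun M hM =>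
    mem_vanishingOn.2 fun x hx => (hK x).1 hx M hM
  let ev : V → A →ₗ[F] W := fun x => (LinearMap.applyₗ x) ∘ₗ A.subtype
  have hcol : ∀ x, (∑ M : A, if M.1 x = 0 then 1 else 0) * q ^ m =
      if x ∈ K then q ^ (m * u) * q ^ m else q ^ (m * u) := by
    intro x
    have h1 : (∑ M : A, if M.1 x = 0 then 1 else 0) = q ^ finrank F (LinearMap.ker (ev x)) := by
      rw [hq, ← sum_ite_eq_zero]
      rfl
    have h2 := (ev x).finrank_range_add_finrank_ker
    rw [hdim] at h2
    have h3 : LinearMap.range (ev x) = valuesAt A x := by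
      simp [ev, valuesAt, LinearMap.range_comp]
    rw [h1]
    split_ifs with hx
    · have : LinearMap.ker (ev x) = ⊤ := by
        rw [LinearMap.ker_eq_top]
        ext M
        exact (hK x).1 hx M.1 M.2
      rw [this, finrank_top, hdim]
    · rw [h3, hval' x hx, finrank_top] at h2
      rw [← pow_add, ← h2, add_comm]
  have hrow : ∀ M : A, q ^ (n - u) ≤ ∑ x : V, if M.1 x = 0 then 1 else 0 := by
    intro M
    rw [sum_ite_eq_zero M.1]
    refine Nat.pow_le_pow_right (by omega) ?_
    have := M.1.finrank_range_add_finrank_ker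
    have := hA M.1 M.2
    omega
  have hcardA : Fintype.card A = q ^ (m * u) := by
    rw [← Nat.card_eq_fintype_card, Module.natCard_eq_pow_finrank (K := F), hdim]
  have hcardV : Fintype.card V = q ^ n := by
    rw [← Nat.card_eq_fintype_card, Module.natCard_eq_pow_finrank (K := F)]
  have hcardK : (Finset.univ.filter fun x => x ∈ K).card = q ^ finrank F K := by
    rw [← Module.natCard_eq_pow_finrank (K := F) (V := K), Nat.card_eq_fintype_card]
    exact (Fintype.card_subtype _).symm
  have hcount : q ^ (m * u) * q ^ (n - u) * q ^ m ≤
      q ^ finrank F K * (q ^ (m * u) * q ^ m) + (q ^ n - q ^ finrank F K) * q ^ (m * u) := by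
    calc q ^ (m * u) * q ^ (n - u) * q ^ m
        = (∑ _M : A, q ^ (n - u)) * q ^ m := by simp [hcardA]
      _ ≤ (∑ M : A, ∑ x : V, if M.1 x = 0 then 1 else 0) * q ^ m :=
          Nat.mul_le_mul_right _ (Finset.sum_le_sum fun M _ => hrow M)
      _ = ∑ x : V, (∑ M : A, if M.1 x = 0 then 1 else 0) * q ^ m := by
          rw [Finset.sum_comm, Finset.sum_mul]
      _ = _ := by
          rw [Finset.sum_congr rfl fun x _ => hcol x, Finset.sum_ite, Finset.sum_const,
            Finset.sum_const, hcardK, Finset.filter_not, Finset.card_sdiff_of_subset (by simp),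
            hcardK, Finset.card_univ, hcardV, smul_eq_mul, smul_eq_mul]
  have hk : n - u ≤ finrank F K := by
    rw [← Nat.pow_le_pow_iff_right hq1]
    have hpos : 0 < q ^ (m * u) := by positivity
    have hKpos : 0 < q ^ finrank F K := by positivity
    have hmpos : 0 < q ^ m := by positivity
    have hnm : q ^ n ≤ q ^ m := Nat.pow_le_pow_right (by omega) hVW
    have h1 : q ^ (n - u) * q ^ m ≤
        q ^ finrank F K * q ^ m + (q ^ n - q ^ finrank F K) :=
      Nat.le_of_mul_le_mul_left (by linarith) hpos
    have h2 : q ^ (n - u) * q ^ m < (q ^ finrank F K + 1) * q ^ m := by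
      rw [add_mul, one_mul]
      omega
    exact Nat.lt_succ_iff.1 (Nat.lt_of_mul_lt_mul_right h2)
  refine ⟨K, Submodule.eq_of_le_of_finrank_le hAK ?_⟩
  rw [finrank_vanishingOn, hdim, mul_comm m u]
  exact Nat.mul_le_mul_right _ (by omega)

end Classification

section Classification
variable {F V W : Type*} [Field F] [AddCommGroup V] [Module F V] [AddCommGroup W] [Module F W]

lemma exists_le_finrank_eq (U : Submodule F W) {v : ℕ} (hv : v ≤ finrank F U) :
    ∃ U' ≤ U, finrank F U' = v := by
  obtain ⟨f, hf⟩ := exists_linearIndependent_of_le_finrank hv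
  refine ⟨(Submodule.span F (Set.range f)).map U.subtype, Submodule.map_subtype_le _ _, ?_⟩
  rw [Submodule.finrank_map_subtype_eq, finrank_span_eq_card hf, Fintype.card_fin]

variable [FiniteDimensional F V] [FiniteDimensional F W]

lemma exists_ge_finrank_eq (K : Submodule F V) {k : ℕ} (hk : finrank F K ≤ k)
    (hkV : k ≤ finrank F V) : ∃ K', K ≤ K' ∧ finrank F K' = k := by
  obtain ⟨L, hL⟩ := K.exists_isCompl
  have h1 := Submodule.finrank_add_eq_of_isCompl hL
  obtain ⟨L', hL', hdim⟩ := exists_le_finrank_eq L (v := k - finrank F K) (by omega)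
  refine ⟨K ⊔ L', le_sup_left, ?_⟩
  have h2 := Submodule.finrank_sup_add_finrank_inf_eq K L'
  rw [(hL.disjoint.mono_right hL').eq_bot, finrank_bot] at h2
  omega

/-- Each subspace is spanned by the first vectors of some basis. -/
lemma exists_basis_mem_iff {n : ℕ} (hn : finrank F W = n) (U : Submodule F W) :
    ∃ c : Basis (Fin n) F W, ∀ w, w ∈ U ↔ ∀ i : Fin n, finrank F U ≤ i → c.repr w i = 0 := by
  have hle : finrank F U ≤ n := hn ▸ Submodule.finrank_le U
  have hli : LinearIndependent F fun k => (finBasis F U k : W) :=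
    (finBasis F U).linearIndependent.map' U.subtype U.ker_subtype
  obtain ⟨c, hc⟩ := exists_basis_castLE hn hli hle
  refine ⟨c, fun w => ⟨fun hw i hi => ?_, fun h => ?_⟩⟩
  · have h0 : c.coord i ∘ₗ U.subtype = 0 := (finBasis F U).ext fun k => by
      have hne : Fin.castLE hle k ≠ i := fun h => by
        have := k.2
        rw [← h] at hi
        simp at hi
        omega
      simp [← hc k, hne]
    exact LinearMap.congr_fun h0 ⟨w, hw⟩
  · rw [← c.sum_repr w]
    refine Submodule.sum_mem _ fun i _ => ?_
    by_cases hi : finrank F U ≤ i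
    · simp [h i hi]
    · refine U.smul_mem _ ?_
      have := hc ⟨i, by omega⟩
      rw [show Fin.castLE hle ⟨i, by omega⟩ = i from rfl] at this
      rw [this]
      exact (finBasis F U _).2

open Classical in
/-- If the space `U` of values at `x` of a square optimal anticode is neither zero nor everything,
then the maps in the anticode that vanish at `x` are all the maps `V → U` vanishing at `x`. Indeed,
in a basis of `V` beginning with `x` and a basis of `W` beginning with one of `U`, the leading
positions fill the rows belonging to `U`. -/
lemma vanishingOn_inf_valuedIn_le {n u : ℕ} (hV : finrank F V = n) (hW : finrank F W = n)
    {A : Submodule F (V →ₗ[F] W)} (hA : ∀ M ∈ A, finrank F (LinearMap.range M) ≤ u)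
    (hdim : finrank F A = n * u) {x : V} (hbot : valuesAt A x ≠ ⊥) (htop : valuesAt A x ≠ ⊤) :
    finrank F (valuesAt A x) = u ∧
      (∀ M ∈ A, M x = 0 → ∀ y, M y ∈ valuesAt A x) ∧
      vanishingOn W (Submodule.span F {x}) ⊓ valuedIn V (valuesAt A x) ≤ A := by
  set U := valuesAt A x with hU
  have hx : x ≠ 0 := by
    rintro rfl
    refine hbot (eq_bot_iff.2 fun w hw => ?_)
    obtain ⟨M, -, rfl⟩ := mem_valuesAt.1 hw
    simp
  have hn : 0 < n := by
    rw [← hV]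
    exact finrank_pos_iff_exists_ne_zero.2 ⟨x, hx⟩
  have hdn : finrank F U < n := hW ▸ Submodule.finrank_lt htop
  obtain ⟨c, hc⟩ := exists_basis_mem_iff hW U
  have hcount : ∀ b : Basis (Fin n) F V, ∀ σ : Fin n → Fin n, Function.Injective σ →
      (Finset.univ.filter fun j => IsPivot A b c j (σ j)).card = u := fun b σ hσ =>
    card_cells_eq hn (hdim ▸ finrank_le_card_isPivot A b c) (fun σ hσ => card_isPivot_le hA b c hσ)
      hσ
  have hrow : ∀ b : Basis (Fin n) F V, b ⟨0, hn⟩ = x →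
      ∀ j i, IsPivot A b c j i ↔ (i : ℕ) < finrank F U := by
    intro b hb
    have hrow : ∀ j j' i, IsPivot A b c j i ↔ IsPivot A b c j' i :=
      (cells_column_or_row (hcount b)).resolve_left fun h => by
        have := valuesAt_eq_bot_or_top h hn
        rw [hb] at this
        exact this.elim hbot htop
    intro j i
    rw [hrow j ⟨0, hn⟩ i]
    constructor
    · rintro ⟨M, hM, -, hlead⟩
      by_contra hi
      exact hlead.1 ((hc _).1 (mem_valuesAt.2 ⟨M, hM, by rw [hb]⟩) i (not_lt.1 hi))
    · intro hi
      have hci : c i ∈ U := (hc _).2 fun i' hi' => by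
        have : i ≠ i' := fun h => by subst h; omega
        simp [this]
      obtain ⟨M, hM, hMx⟩ := mem_valuesAt.1 hci
      refine ⟨M, hM, fun j' hj' => absurd hj' (by simp [Fin.lt_def]), ?_⟩
      rw [hb, hMx]
      refine ⟨by simp, fun i' hi' => ?_⟩
      simp [hi'.ne]
  have hd : finrank F U = u := by
    obtain ⟨b, hb⟩ := exists_basis_castLE hV (v := ![x])
      (LinearIndependent.of_subsingleton 0 (by simpa using hx)) (by omega)
    have := hcount b id Function.injective_id
    simp only [hrow b (hb 0), id] at this
    rw [Fin.card_filter_val_lt] at this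
    omega
  have hvan : ∀ M ∈ A, M x = 0 → ∀ y, M y ∈ U := by
    intro M hM hMx y
    by_cases hy : ∃ a : F, a • x = y
    · obtain ⟨a, rfl⟩ := hy
      simp [hMx]
    push Not at hy
    have hli : LinearIndependent F ![x, y] := (LinearIndependent.pair_iff' hx).2 hy
    have h2n : 2 ≤ n := by simpa [hV] using hli.fintype_card_le_finrank
    obtain ⟨b, hb⟩ := exists_basis_castLE hV hli h2n
    by_contra hMy
    obtain ⟨i, hi⟩ := exists_isLead c (w := M y) fun h => hMy (h ▸ U.zero_mem)
    have hpiv : IsPivot A b c ⟨1, h2n⟩ i := by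
      refine ⟨M, hM, fun j' hj' => ?_, ?_⟩
      · have : j' = Fin.castLE h2n 0 := by
          ext
          simp [Fin.lt_def] at hj' ⊢
          exact hj'
        rw [this, hb]
        exact hMx
      · rw [show (⟨1, h2n⟩ : Fin n) = Fin.castLE h2n 1 from rfl, hb]
        exact hi
    rw [hrow b (hb 0)] at hpiv
    exact hMy ((hc _).2 fun i' hi' => hi.2 i' (Fin.lt_def.2 (by omega)))
  refine ⟨hd, hvan, ?_⟩
  -- comparing dimensions turns the inclusion just proved into an equality
  let ev : A →ₗ[F] W := (LinearMap.applyₗ x) ∘ₗ A.subtype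
  have hev : LinearMap.range ev = U := by simp [ev, hU, valuesAt, LinearMap.range_comp]
  have hle : (LinearMap.ker ev).map A.subtype ≤
      vanishingOn W (Submodule.span F {x}) ⊓ valuedIn V U := by
    rintro _ ⟨⟨M, hM⟩, h0, rfl⟩
    have h0 : M x = 0 := h0
    refine ⟨mem_vanishingOn.2 ?_, mem_valuedIn.2 (hvan M hM h0)⟩
    simpa using h0
  have heq := Submodule.eq_of_le_of_finrank_le hle (by
    have h1 := ev.finrank_range_add_finrank_ker
    rw [hev, hdim] at h1
    rw [finrank_vanishingOn_inf_valuedIn, Submodule.finrank_map_subtype_eq, hV,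
      finrank_span_singleton hx, hd, Nat.sub_mul, one_mul]
    omega)
  rw [← heq]
  exact Submodule.map_subtype_le _ _

/-- In the situation of `vanishingOn_inf_valuedIn_le`, a map in `A` with a value outside `U` could
be changed by a map vanishing at `x` into one of too large a rank. -/
lemma eq_valuedIn {n u : ℕ} (hV : finrank F V = n) (hW : finrank F W = n)
    {A : Submodule F (V →ₗ[F] W)} (hA : ∀ M ∈ A, finrank F (LinearMap.range M) ≤ u)
    (hdim : finrank F A = n * u) {x : V} (hbot : valuesAt A x ≠ ⊥) (htop : valuesAt A x ≠ ⊤) :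
    A = valuedIn V (valuesAt A x) := by
  obtain ⟨hd, hvan, hle⟩ := vanishingOn_inf_valuedIn_le hV hW hA hdim hbot htop
  have hdn : finrank F (valuesAt A x) < n :=
    hW ▸ Submodule.finrank_lt htop
  have hx : ∀ M ∈ A, M x ∈ valuesAt A x := fun M hM => mem_valuesAt.2 ⟨M, hM, rfl⟩
  set U := valuesAt A x with hU
  refine Submodule.eq_of_le_of_finrank_le (fun N hN => mem_valuedIn.2 fun y => ?_) ?_
  swap
  · rw [finrank_valuedIn, hV, hd, hdim]
  by_contra hy
  have hNx : N x ≠ 0 := fun h => hy (hvan N hN h y)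
  have hx0 : x ≠ 0 := fun h => hNx (by simp [h])
  have hli : LinearIndependent F ![y, x] := by
    refine LinearIndependent.pair_symm_iff.1 ((LinearIndependent.pair_iff' hx0).2 ?_)
    rintro a rfl
    exact hy (by simpa using U.smul_mem a (hx N hN))
  have h2n : 2 ≤ n := by simpa [hV] using hli.fintype_card_le_finrank
  obtain ⟨b, hb⟩ := exists_basis_castLE hV hli h2n
  have hb0 : b ⟨0, by omega⟩ = y := hb 0
  have hb1 : b ⟨1, h2n⟩ = x := hb 1
  have hdpos : 1 ≤ finrank F U := Submodule.one_le_finrank_iff.2 hbot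
  obtain ⟨e, he⟩ := exists_basis_castLE (F := F) (V := U) rfl (v := ![⟨N x, hx N hN⟩])
    (LinearIndependent.of_subsingleton 0 (by simpa [Subtype.ext_iff] using hNx)) hdpos
  have he0 : e ⟨0, hdpos⟩ = ⟨N x, hx N hN⟩ := he 0
  -- a surjection `g` onto `U` with `g y = 0` and `g x = N x`
  let g : V →ₗ[F] U := b.constr F fun j =>
    if h : 1 ≤ j.1 ∧ j.1 - 1 < finrank F U then e ⟨j.1 - 1, h.2⟩ else 0
  have hgy : g y = 0 := by
    rw [← hb0]
    simp only [g, Basis.constr_basis]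
    rw [dif_neg (by simp)]
  have hgx : g x = ⟨N x, hx N hN⟩ := by
    have : g (b ⟨1, h2n⟩) = e ⟨0, hdpos⟩ := by
      simp only [g, Basis.constr_basis]
      rw [dif_pos ⟨le_rfl, hdpos⟩]
    rw [← he0, ← this, hb1]
  have hg : LinearMap.range g = ⊤ := by
    rw [eq_top_iff, ← e.span_eq, Submodule.span_le]
    rintro _ ⟨k, rfl⟩
    refine ⟨b ⟨k.1 + 1, by omega⟩, ?_⟩
    simp only [g, Basis.constr_basis]
    rw [dif_pos ⟨by simp, by simp⟩]
    simp
  obtain ⟨π, hπ⟩ := LinearMap.exists_leftInverse_of_injective U.subtype U.ker_subtype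
  have hπU : ∀ w : U, π w = w := fun w => LinearMap.congr_fun hπ w
  let T : V →ₗ[F] W := N + U.subtype ∘ₗ (g - π ∘ₗ N)
  have hTA : T ∈ A := by
    refine A.add_mem hN (hle ⟨mem_vanishingOn.2 ?_, mem_valuedIn.2 fun z => ?_⟩)
    · have : π (N x) = ⟨N x, hx N hN⟩ := hπU ⟨N x, hx N hN⟩
      simp [hgx, this]
    · exact ((g - π ∘ₗ N) z).2
  have hπT : ∀ z, π (T z) = g z := fun z => by
    have : π (T z) = π (N z) + π ((g z - π (N z) : U) : W) := by simp [T]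
    rw [this, hπU]
    abel
  have hTy : T y ≠ 0 := by
    intro h0
    apply hy
    have h1 : N y = ((π (N y) : U) : W) := by
      have : T y = N y + ((g y - π (N y) : U) : W) := rfl
      rw [h0, hgy, zero_sub, Submodule.coe_neg] at this
      exact (sub_eq_zero.1 (by rw [sub_eq_add_neg]; exact this.symm))
    rw [h1]
    exact Subtype.property _
  let p : LinearMap.range T →ₗ[F] U := π ∘ₗ (LinearMap.range T).subtype
  have hp : LinearMap.range p = ⊤ := by
    rw [eq_top_iff, ← hg]
    rintro _ ⟨z, rfl⟩
    exact ⟨⟨T z, z, rfl⟩, hπT z⟩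
  have hker : 1 ≤ finrank F (LinearMap.ker p) := by
    rw [Submodule.one_le_finrank_iff]
    intro hbot
    have : (⟨T y, y, rfl⟩ : LinearMap.range T) ∈ LinearMap.ker p :=
      (hπT y).trans hgy
    rw [hbot, Submodule.mem_bot] at this
    exact hTy (congrArg Subtype.val this)
  have h1 := p.finrank_range_add_finrank_ker
  rw [hp, finrank_top] at h1
  have := hA T hTA
  omega

/-- Over a finite field, an optimal anticode consists of all maps vanishing on a subspace, or of
all maps with values in a subspace. -/
theorem eq_vanishingOn_or_eq_valuedIn [Finite F] {A : Submodule F (V →ₗ[F] W)} {u : ℕ}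
    (hVW : finrank F V ≤ finrank F W) (hA : ∀ M ∈ A, finrank F (LinearMap.range M) ≤ u)
    (hdim : finrank F A = finrank F W * u) :
    (∃ K : Submodule F V, A = vanishingOn W K) ∨
      (finrank F V = finrank F W ∧ ∃ U : Submodule F W, A = valuedIn V U) := by
  classical
  by_cases hval : ∀ x, valuesAt A x = ⊥ ∨ valuesAt A x = ⊤
  · exact Or.inl (exists_eq_vanishingOn hVW hA hdim hval)
  push Not at hval
  obtain ⟨x, hbot, htop⟩ := hval
  rcases hVW.lt_or_eq with hlt | heq
  · exfalso
    have hx : x ≠ 0 := by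
      rintro rfl
      refine hbot (eq_bot_iff.2 fun w hw => ?_)
      obtain ⟨M, -, rfl⟩ := mem_valuesAt.1 hw
      simp
    have hn : 0 < finrank F V := finrank_pos_iff_exists_ne_zero.2 ⟨x, hx⟩
    obtain ⟨b, hb⟩ := exists_basis_castLE (F := F) (V := V) rfl (v := ![x])
      (LinearIndependent.of_subsingleton 0 (by simpa using hx)) hn
    have hb0 : b ⟨0, hn⟩ = x := hb 0
    let c := finBasis F W
    have hcol := cells_column_of_lt hlt fun σ hσ =>
      card_cells_eq (by omega) (hdim ▸ finrank_le_card_isPivot A b c)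
        (fun σ hσ => card_isPivot_le hA b c hσ) hσ
    have := valuesAt_eq_bot_or_top hcol hn
    rw [hb0] at this
    exact this.elim hbot htop
  · exact Or.inr ⟨heq, _, eq_valuedIn heq rfl hA hdim hbot htop⟩

/-- An optimal anticode contains optimal anticodes of all smaller maximum ranks. -/
theorem exists_subanticode [Finite F] {A : Submodule F (V →ₗ[F] W)} {u v : ℕ}
    (hVW : finrank F V ≤ finrank F W) (hA : ∀ M ∈ A, finrank F (LinearMap.range M) ≤ u)
    (hdim : finrank F A = finrank F W * u) (hvu : v ≤ u) :
    ∃ B ≤ A, finrank F B = finrank F W * v ∧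
      ∀ M ∈ B, finrank F (LinearMap.range M) ≤ v := by
  rcases Nat.eq_zero_or_pos (finrank F W) with hW | hW
  · refine ⟨⊥, bot_le, by simp [hW], fun M hM => ?_⟩
    rw [(Submodule.mem_bot F).1 hM, LinearMap.range_zero, finrank_bot]
    exact Nat.zero_le _
  rcases eq_vanishingOn_or_eq_valuedIn hVW hA hdim with ⟨K, rfl⟩ | ⟨heq, U, rfl⟩
  · rw [finrank_vanishingOn, mul_comm] at hdim
    have hu := Nat.eq_of_mul_eq_mul_left hW hdim
    have hK := Submodule.finrank_le K
    obtain ⟨K', hKK', hK'⟩ := exists_ge_finrank_eq K (k := finrank F V - v) (by omega) (by omega)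
    refine ⟨vanishingOn W K', fun M hM => ?_, ?_, fun M hM => ?_⟩
    · exact mem_vanishingOn.2 (hKK'.trans (mem_vanishingOn.1 hM))
    · rw [finrank_vanishingOn, hK', mul_comm, Nat.sub_sub_self (by omega)]
    · have := finrank_range_le_of_mem_vanishingOn hM
      omega
  · rw [finrank_valuedIn, heq] at hdim
    have hu := Nat.eq_of_mul_eq_mul_left hW hdim
    obtain ⟨U', hUU', hU'⟩ := exists_le_finrank_eq U (v := v) (by omega)
    refine ⟨valuedIn V U', fun M hM => ?_, ?_, fun M hM => ?_⟩
    · exact mem_valuedIn.2 fun x => hUU' (mem_valuedIn.1 hM x)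
    · rw [finrank_valuedIn, heq, hU']
    · rw [← hU']
      refine Submodule.finrank_mono ?_
      rintro _ ⟨x, rfl⟩
      exact mem_valuedIn.1 hM x

end Classification

/-! ### Filling the blocks from the left -/

section Filling
variable {ℓ : ℕ}

/-- The share of block `i` when the first `h` of all columns are taken. -/
def fill (n : Fin ℓ → ℕ) (h : ℕ) (i : Fin ℓ) : ℕ :=
  min (n i) (h - ∑ i' ∈ Finset.Iio i, n i')

/-- The number of matrix entries in the first `h` of all columns. -/
def fillDim (m n : Fin ℓ → ℕ) (h : ℕ) : ℕ :=
  ∑ i, m i * fill n h i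

lemma fill_le (n : Fin ℓ → ℕ) (h : ℕ) (i : Fin ℓ) : fill n h i ≤ n i :=
  min_le_left _ _

lemma fillDim_mono (m n : Fin ℓ → ℕ) : Monotone (fillDim m n) := fun _ _ hh =>
  Finset.sum_le_sum fun _ _ => Nat.mul_le_mul_left _
    (min_le_min le_rfl (Nat.sub_le_sub_right hh _))

lemma sum_Iio_add_self (n : Fin ℓ → ℕ) (i : Fin ℓ) :
    ∑ i' ∈ Finset.Iio i, n i' + n i = ∑ i' ∈ Finset.Iic i, n i' := by
  rw [← Finset.Iio_insert, Finset.sum_insert (by simp), add_comm]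

lemma sum_Iic_le_sum_Iio (n : Fin ℓ → ℕ) {i j : Fin ℓ} (hij : i < j) :
    ∑ i' ∈ Finset.Iic i, n i' ≤ ∑ i' ∈ Finset.Iio j, n i' :=
  Finset.sum_le_sum_of_subset fun _ h =>
    Finset.mem_Iio.2 ((Finset.mem_Iic.1 h).trans_lt hij)

lemma le_sum_Iic_of_isBlockOf {n : Fin ℓ → ℕ} {h : ℕ} {k : Fin ℓ} (hk : IsBlockOf n h k)
    (hh : h ≤ ∑ i, n i) : h ≤ ∑ i ∈ Finset.Iic k, n i := by
  by_cases hlast : k.1 + 1 < ℓ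
  · have hnext : Finset.Iio (⟨k.1 + 1, hlast⟩ : Fin ℓ) = Finset.Iic k := by
      ext i
      simp only [Finset.mem_Iio, Finset.mem_Iic, Fin.lt_def, Fin.le_def]
      omega
    by_contra! hcon
    rw [← hnext] at hcon
    have := Fin.le_def.1 (hk.2 hcon)
    simp at this
  · have : Finset.Iic k = Finset.univ := by
      ext i
      simp only [Finset.mem_Iic, Finset.mem_univ, Fin.le_def, iff_true]
      omega
    rwa [this]

lemma exists_isBlockOf {n : Fin ℓ → ℕ} {h : ℕ} (h0 : 0 < h) (hh : h ≤ ∑ i, n i) :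
    ∃ k, IsBlockOf n h k := by
  have hℓ : 0 < ℓ := by
    rcases Nat.eq_zero_or_pos ℓ with rfl | hℓ
    · simp at hh
      omega
    · exact hℓ
  have hne : {ν : Fin ℓ | ∑ i ∈ Finset.Iio ν, n i < h}.Nonempty := by
    refine ⟨⟨0, hℓ⟩, ?_⟩
    have : Finset.Iio (⟨0, hℓ⟩ : Fin ℓ) = ∅ := by
      ext i
      simp [Fin.lt_def]
    simpa [this] using h0
  obtain ⟨k, hk, hmax⟩ := Set.exists_max_image _ id (Set.toFinite _) hne
  exact ⟨k, hk, hmax⟩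

lemma fill_succ {n : Fin ℓ → ℕ} {h : ℕ} {k : Fin ℓ} (hk : IsBlockOf n (h + 1) k)
    (hh : h + 1 ≤ ∑ i, n i) (i : Fin ℓ) :
    fill n (h + 1) i = fill n h i + if i = k then 1 else 0 := by
  have h1 : ∑ i ∈ Finset.Iio k, n i < h + 1 := hk.1
  have h2 := le_sum_Iic_of_isBlockOf hk hh
  rw [← sum_Iio_add_self] at h2
  unfold fill
  rcases lt_trichotomy i k with hi | rfl | hi
  · have := sum_Iic_le_sum_Iio n hi
    rw [← sum_Iio_add_self] at this
    rw [if_neg hi.ne]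
    omega
  · rw [if_pos rfl]
    omega
  · have : ¬ ∑ i' ∈ Finset.Iio i, n i' < h + 1 := fun hlt => absurd (hk.2 hlt) (not_le.2 hi)
    rw [if_neg hi.ne']
    omega

lemma fillDim_succ (m : Fin ℓ → ℕ) {n : Fin ℓ → ℕ} {h : ℕ} {k : Fin ℓ}
    (hk : IsBlockOf n (h + 1) k) (hh : h + 1 ≤ ∑ i, n i) :
    fillDim m n (h + 1) = fillDim m n h + m k := by
  simp [fillDim, fill_succ hk hh, mul_add, Finset.sum_add_distrib]

lemma sum_fill {n : Fin ℓ → ℕ} {h : ℕ} (hh : h ≤ ∑ i, n i) : ∑ i, fill n h i = h := by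
  induction h with
  | zero => simp [fill]
  | succ h ih =>
    obtain ⟨k, hk⟩ := exists_isBlockOf (Nat.succ_pos h) hh
    simp [fill_succ hk hh, Finset.sum_add_distrib, ih (by omega)]

lemma fillDim_sum (m n : Fin ℓ → ℕ) : fillDim m n (∑ i, n i) = ∑ i, m i * n i := by
  refine Finset.sum_congr rfl fun i _ => ?_
  have : ∑ i' ∈ Finset.Iic i, n i' ≤ ∑ i', n i' :=
    Finset.sum_le_sum_of_subset (Finset.subset_univ _)
  rw [← sum_Iio_add_self] at this
  unfold fill
  congr 1
  omega

lemma sum_Ici_add_fillDim (m n : Fin ℓ → ℕ) {j : Fin ℓ} {δ : ℕ} (hδ : δ < n j) :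
    ∑ i ∈ Finset.Ici j, m i * n i + fillDim m n (∑ i ∈ Finset.Iio j, n i + δ) =
      ∑ i, m i * n i + δ * m j := by
  have h1 : fillDim m n (∑ i ∈ Finset.Iio j, n i + δ) =
      ∑ i ∈ Finset.Iio j, m i * n i + δ * m j := by
    rw [fillDim, ← Finset.sum_subset (Finset.subset_univ (Finset.Iic j)), ← Finset.Iio_insert,
      Finset.sum_insert (by simp), add_comm]
    · congr 1
      · refine Finset.sum_congr rfl fun i hi => ?_
        have := sum_Iic_le_sum_Iio n (Finset.mem_Iio.1 hi)
        rw [← sum_Iio_add_self] at this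
        unfold fill
        congr 1
        omega
      · unfold fill
        rw [Nat.add_sub_cancel_left, min_eq_right hδ.le, mul_comm]
    · intro i _ hi
      have := sum_Iic_le_sum_Iio n (not_le.1 fun h => hi (Finset.mem_Iic.2 h))
      rw [← sum_Iio_add_self] at this
      unfold fill
      rw [Nat.sub_eq_zero_of_le (by omega)]
      simp
  have h2 : ∑ i ∈ Finset.Ici j, m i * n i + ∑ i ∈ Finset.Iio j, m i * n i = ∑ i, m i * n i := by
    rw [← Finset.sum_union]
    · congr 1
      ext i
      simp [le_or_gt]
    · rw [Finset.disjoint_left]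
      intro i hi hi'
      exact absurd (Finset.mem_Iio.1 hi') (not_lt.2 (Finset.mem_Ici.1 hi))
  omega

/-- A vector `u ≤ n` with sum `μ` dominates a vector `v` with sum `e` such that the columns of `u`
outside `v` have together no more entries than the columns `e + 1, …, μ` of the whole space. The
columns of `u` are dropped one by one from the right: the last of `e + 1` columns lies in the same
block as column `e + 1` of the whole space or further to the right, where columns are no longer. -/
lemma exists_le_sum_eq {m n u : Fin ℓ → ℕ} (hm : Antitone m) (hu : ∀ i, u i ≤ n i) {e : ℕ}
    (he : e ≤ ∑ i, u i) :
    ∃ v : Fin ℓ → ℕ, (∀ i, v i ≤ u i) ∧ ∑ i, v i = e ∧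
      ∑ i, m i * u i + fillDim m n e ≤ fillDim m n (∑ i, u i) + ∑ i, m i * v i := by
  obtain ⟨d, hd⟩ := Nat.exists_eq_add_of_le he
  clear he
  induction d generalizing e with
  | zero => exact ⟨u, fun _ => le_rfl, by omega, by rw [hd, add_zero, add_comm]⟩
  | succ d ih =>
    obtain ⟨v, hvu, hv, hle⟩ := ih (e := e + 1) (by omega)
    have hsum : ∑ i, u i ≤ ∑ i, n i := Finset.sum_le_sum fun i _ => hu i
    obtain ⟨k, hk⟩ := exists_isBlockOf (n := n) (Nat.succ_pos e) (by omega)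
    have hne : ∃ i, v i ≠ 0 := by
      by_contra! h
      simp [h] at hv
    obtain ⟨k', hk', hmax⟩ := Set.exists_max_image {i | v i ≠ 0} id (Set.toFinite _) hne
    have hk' : v k' ≠ 0 := hk'
    have hkk' : k ≤ k' := by
      by_contra! hlt
      have h1 : e + 1 ≤ ∑ i ∈ Finset.Iic k', v i := by
        rw [← hv]
        refine (Finset.sum_subset (Finset.subset_univ _) fun i _ hi => ?_).ge
        by_contra hvi
        exact hi (Finset.mem_Iic.2 (hmax i hvi))
      have h2 : ∑ i ∈ Finset.Iic k', v i ≤ ∑ i ∈ Finset.Iic k', n i :=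
        Finset.sum_le_sum fun i _ => (hvu i).trans (hu i)
      have h3 := sum_Iic_le_sum_Iio n hlt
      have h4 : ∑ i ∈ Finset.Iio k, n i < e + 1 := hk.1
      omega
    have hsplit : ∀ f : Fin ℓ → ℕ, ∑ i, f i * v i =
        ∑ i, f i * Function.update v k' (v k' - 1) i + f k' := fun f => by
      rw [← Finset.add_sum_erase _ _ (Finset.mem_univ k'),
        ← Finset.add_sum_erase Finset.univ (fun i => f i * Function.update v k' (v k' - 1) i)
          (Finset.mem_univ k'), Function.update_self,
        Finset.sum_congr (f := fun i => f i * Function.update v k' (v k' - 1) i)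
          (g := fun i => f i * v i) rfl fun i hi => by
            rw [Function.update_of_ne (Finset.ne_of_mem_erase hi)]]
      obtain ⟨w, hw⟩ := Nat.exists_eq_succ_of_ne_zero hk'
      rw [hw, Nat.succ_sub_one, Nat.succ_eq_add_one]
      ring
    refine ⟨Function.update v k' (v k' - 1), fun i => ?_, ?_, ?_⟩
    · by_cases hi : i = k'
      · subst hi
        rw [Function.update_self]
        exact (Nat.sub_le _ _).trans (hvu _)
      · rw [Function.update_of_ne hi]
        exact hvu i
    · have := hsplit fun _ => 1
      simp only [one_mul] at this
      omega
    · have h1 := hsplit m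
      have h2 := fillDim_succ m hk (by omega)
      have h3 := hm hkk'
      omega

lemma sum_mul_le_fillDim {m n u : Fin ℓ → ℕ} (hm : Antitone m) (hu : ∀ i, u i ≤ n i) :
    ∑ i, m i * u i ≤ fillDim m n (∑ i, u i) := by
  obtain ⟨v, -, hv, h⟩ := exists_le_sum_eq hm hu (Nat.zero_le _)
  have : ∀ i, v i = 0 := by simpa using hv
  simp only [this, mul_zero, Finset.sum_const_zero, add_zero] at h
  omega

end Filling

/-! ### Optimal anticodes of matrices -/

section MatrixAnticodes
variable {F : Type*} [Field F] {a b : ℕ}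

lemma finrank_range_toLin' (M : Matrix (Fin a) (Fin b) F) :
    finrank F (LinearMap.range (Matrix.toLin' M)) = M.rank := rfl

lemma finrank_le_mul_of_rank_le (hba : b ≤ a) {A : Submodule F (Matrix (Fin a) (Fin b) F)} {u : ℕ}
    (hA : ∀ M ∈ A, M.rank ≤ u) : finrank F A ≤ a * u := by
  have := finrank_le_of_rank_le (A := A.map (Matrix.toLin' (R := F)).toLinearMap) (u := u)
    (by simpa using hba) (by
      rintro _ ⟨M, hM, rfl⟩
      exact hA M hM)
  rwa [LinearEquiv.finrank_map_eq, finrank_fin_fun] at this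

lemma exists_matrix_subanticode [Finite F] (hba : b ≤ a)
    {A : Submodule F (Matrix (Fin a) (Fin b) F)} {u v : ℕ} (hA : ∀ M ∈ A, M.rank ≤ u)
    (hdim : finrank F A = a * u) (hvu : v ≤ u) :
    ∃ B ≤ A, finrank F B = a * v ∧ ∀ M ∈ B, M.rank ≤ v := by
  obtain ⟨B, hB, hBdim, hBrank⟩ :=
    exists_subanticode (A := A.map (Matrix.toLin' (R := F)).toLinearMap) (u := u) (v := v)
      (by simpa using hba) (by
        rintro _ ⟨M, hM, rfl⟩
        exact hA M hM) (by rw [LinearEquiv.finrank_map_eq, finrank_fin_fun, hdim]) hvu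
  refine ⟨B.map (Matrix.toLin' (R := F)).symm.toLinearMap, ?_, ?_, ?_⟩
  · rintro _ ⟨f, hf, rfl⟩
    obtain ⟨M, hM, rfl⟩ := hB hf
    simpa using hM
  · rw [LinearEquiv.finrank_map_eq, hBdim, finrank_fin_fun]
  · rintro _ ⟨f, hf, rfl⟩
    rw [← finrank_range_toLin', LinearEquiv.coe_coe, LinearEquiv.apply_symm_apply]
    exact hBrank f hf

lemma exists_rank_eq (ha : 0 < a) (hba : b ≤ a) {A : Submodule F (Matrix (Fin a) (Fin b) F)}
    {u : ℕ} (hA : ∀ M ∈ A, M.rank ≤ u) (hdim : finrank F A = a * u) : ∃ M ∈ A, M.rank = u := by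
  by_contra! hne
  rcases Nat.eq_zero_or_pos u with rfl | hu
  · exact hne 0 A.zero_mem Matrix.rank_zero
  · have := finrank_le_mul_of_rank_le hba (u := u - 1) fun M hM => by
      have := hA M hM
      have := hne M hM
      omega
    rw [hdim] at this
    have := Nat.le_of_mul_le_mul_left this ha
    omega

lemma isOptimalAnticode_iff (ha : 0 < a) (hba : b ≤ a)
    {A : Submodule F (Matrix (Fin a) (Fin b) F)} :
    IsOptimalAnticode A ↔ ∃ u, finrank F A = a * u ∧ ∀ M ∈ A, M.rank ≤ u := by
  constructor
  · rintro ⟨⟨M, hM, hw⟩, hub⟩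
    refine ⟨M.rank, hw.symm, fun M' hM' => ?_⟩
    have := hub ⟨M', hM', rfl⟩
    rw [← hw] at this
    exact Nat.le_of_mul_le_mul_left this ha
  · rintro ⟨u, hdim, hA⟩
    obtain ⟨M, hM, hMu⟩ := exists_rank_eq ha hba hA hdim
    refine ⟨⟨M, hM, by rw [hMu, hdim]⟩, ?_⟩
    rintro _ ⟨M', hM', rfl⟩
    rw [hdim]
    exact Nat.mul_le_mul_left _ (hA M' hM')

end MatrixAnticodes

/-! ### Products of optimal anticodes -/

section Products
variable {F : Type*} [Field F] {ℓ : ℕ} {m n : Fin ℓ → ℕ}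

lemma mem_prodCode {B : ∀ i : Fin ℓ, Submodule F (Matrix (Fin (m i)) (Fin (n i)) F)}
    {x : Space F m n} : x ∈ prodCode B ↔ ∀ i, x i ∈ B i := by
  simp [prodCode]

lemma finrank_prodCode (B : ∀ i : Fin ℓ, Submodule F (Matrix (Fin (m i)) (Fin (n i)) F)) :
    finrank F (prodCode B) = ∑ i, finrank F (B i) := by
  let f : (∀ i, B i) →ₗ[F] Space F m n :=
    LinearMap.pi fun i => (B i).subtype ∘ₗ LinearMap.proj i
  have hf : Function.Injective f := fun x y h => by
    funext i
    exact Subtype.ext (congrFun h i)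
  have hrange : LinearMap.range f = prodCode B := by
    ext x
    rw [mem_prodCode]
    constructor
    · rintro ⟨y, rfl⟩ i
      exact (y i).2
    · exact fun h => ⟨fun i => ⟨x i, h i⟩, rfl⟩
  rw [← hrange, LinearMap.finrank_range_of_inj hf, Module.finrank_pi_fintype]

lemma srk_le_of_mem_prodCode {B : ∀ i : Fin ℓ, Submodule F (Matrix (Fin (m i)) (Fin (n i)) F)}
    {u : Fin ℓ → ℕ} (hB : ∀ i, ∀ M ∈ B i, M.rank ≤ u i) {x : Space F m n}
    (hx : x ∈ prodCode B) : srk x ≤ ∑ i, u i :=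
  Finset.sum_le_sum fun i _ => hB i _ (mem_prodCode.1 hx i)

lemma maxSrk_prodCode (hm : ∀ i, 0 < m i) (hnm : ∀ i, n i ≤ m i)
    {B : ∀ i : Fin ℓ, Submodule F (Matrix (Fin (m i)) (Fin (n i)) F)}
    {u : Fin ℓ → ℕ} (hB : ∀ i, ∀ M ∈ B i, M.rank ≤ u i) (hdim : ∀ i, finrank F (B i) = m i * u i) :
    maxSrk (prodCode B) = ∑ i, u i := by
  refine IsGreatest.csSup_eq ⟨?_, ?_⟩
  · choose x hx hxu using fun i => exists_rank_eq (hm i) (hnm i) (hB i) (hdim i)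
    exact ⟨x, mem_prodCode.2 hx, Finset.sum_congr rfl fun i _ => hxu i⟩
  · rintro _ ⟨x, hx, rfl⟩
    exact srk_le_of_mem_prodCode hB hx

/-- A product of optimal anticodes is described by the maximum ranks `u i` in the blocks, and
all smaller maximum ranks occur among its subspaces. -/
lemma IsProductAnticode.exists_ranks [Finite F] (hm : ∀ i, 0 < m i) (hnm : ∀ i, n i ≤ m i)
    {A : Code F m n} (hA : IsProductAnticode A) :
    ∃ u : Fin ℓ → ℕ, (∀ i, u i ≤ n i) ∧ finrank F A = ∑ i, m i * u i ∧ maxSrk A = ∑ i, u i ∧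
      ∀ v : Fin ℓ → ℕ, (∀ i, v i ≤ u i) →
        ∃ B ≤ A, finrank F B = ∑ i, m i * v i ∧ ∀ x ∈ B, srk x ≤ ∑ i, v i := by
  obtain ⟨B, hB, rfl⟩ := hA
  choose u hdim hu using fun i => (isOptimalAnticode_iff (hm i) (hnm i)).1 (hB i)
  refine ⟨u, fun i => ?_, ?_, maxSrk_prodCode hm hnm hu hdim, fun v hv => ?_⟩
  · obtain ⟨M, -, hM⟩ := exists_rank_eq (hm i) (hnm i) (hu i) (hdim i)
    rw [← hM]
    exact M.rank_le_width
  · rw [finrank_prodCode]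
    exact Finset.sum_congr rfl fun i _ => hdim i
  · choose B' hle hdim' hrank using fun i =>
      exists_matrix_subanticode (hnm i) (hu i) (hdim i) (hv i)
    refine ⟨prodCode B', fun x hx => ?_, ?_, fun x hx => srk_le_of_mem_prodCode hrank hx⟩
    · exact mem_prodCode.2 fun i => hle i (mem_prodCode.1 hx i)
    · rw [finrank_prodCode]
      exact Finset.sum_congr rfl fun i _ => hdim' i

lemma exists_isProductAnticode [Finite F] (hm : ∀ i, 0 < m i) (hnm : ∀ i, n i ≤ m i)
    {v : Fin ℓ → ℕ} (hv : ∀ i, v i ≤ n i) :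
    ∃ A : Code F m n, IsProductAnticode A ∧ finrank F A = ∑ i, m i * v i ∧
      maxSrk A = ∑ i, v i := by
  choose B _ hdim hrank using fun i =>
    exists_matrix_subanticode (F := F) (hnm i) (A := ⊤) (fun M _ => M.rank_le_width)
      (by simp [Module.finrank_matrix]) (hv i)
  refine ⟨prodCode B, ⟨B, fun i => ?_, rfl⟩, ?_, maxSrk_prodCode hm hnm hrank hdim⟩
  · exact (isOptimalAnticode_iff (hm i) (hnm i)).2 ⟨v i, hdim i, hrank i⟩
  · rw [finrank_prodCode]
    exact Finset.sum_congr rfl fun i _ => hdim i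

lemma exists_isProductAnticode_fillDim [Finite F] (hm : ∀ i, 0 < m i) (hnm : ∀ i, n i ≤ m i)
    {h : ℕ} (hh : h ≤ ∑ i, n i) :
    ∃ A : Code F m n, IsProductAnticode A ∧ finrank F A = fillDim m n h ∧ maxSrk A = h := by
  obtain ⟨A, hA, hdim, hmax⟩ := exists_isProductAnticode (F := F) hm hnm (fill_le n h)
  exact ⟨A, hA, hdim, hmax.trans (sum_fill hh)⟩

lemma maxAnticodeDim_eq [Finite F] (hanti : Antitone m) (hm : ∀ i, 0 < m i)
    (hnm : ∀ i, n i ≤ m i) {h : ℕ} (hh : h ≤ ∑ i, n i) :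
    maxAnticodeDim F m n h = fillDim m n h := by
  refine IsGreatest.csSup_eq ⟨?_, ?_⟩
  · obtain ⟨A, hA, hdim, hmax⟩ := exists_isProductAnticode_fillDim (F := F) hm hnm hh
    exact ⟨A, hA, hmax, hdim⟩
  · rintro _ ⟨A, hA, rfl, rfl⟩
    obtain ⟨u, hu, hdim, hmax, -⟩ := hA.exists_ranks hm hnm
    rw [hdim, hmax]
    exact sum_mul_le_fillDim hanti hu

/-! ### Generalized weights of MSRD codes -/

/-- Inside a product `A` of optimal anticodes, `C` meets trivially every subspace `B` whose sum-rank
weights stay below the minimum distance, so `dim (C ∩ A) ≤ dim A - dim B`; the `B` provided by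
`exists_le_sum_eq` gives this bound. -/
lemma finrank_inf_add_fillDim_le [Finite F] (hanti : Antitone m) (hm : ∀ i, 0 < m i)
    (hnm : ∀ i, n i ≤ m i) (C : Code F m n) (hd : 0 < minDist C) {A : Code F m n}
    (hA : IsProductAnticode A) :
    finrank F (C ⊓ A : Code F m n) + fillDim m n (min (minDist C - 1) (maxSrk A)) ≤
      fillDim m n (maxSrk A) := by
  obtain ⟨u, hu, hdim, hmax, hsub⟩ := hA.exists_ranks hm hnm
  rw [hmax]
  obtain ⟨v, hvu, hv, hle⟩ :=
    exists_le_sum_eq (e := min (minDist C - 1) (∑ i, u i)) hanti hu (min_le_right _ _)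
  obtain ⟨B, hBA, hBdim, hB⟩ := hsub v hvu
  have hinf : (C ⊓ A) ⊓ B = ⊥ := by
    rw [eq_bot_iff]
    rintro x ⟨⟨hxC, -⟩, hxB⟩
    by_contra hx
    have h1 : minDist C ≤ srk x := Nat.sInf_le ⟨x, hxC, hx, rfl⟩
    have h2 := hB x hxB
    omega
  have h1 := Submodule.finrank_sup_add_finrank_inf_eq (C ⊓ A) B
  have h2 : finrank F ((C ⊓ A) ⊔ B : Code F m n) ≤ finrank F A :=
    Submodule.finrank_mono (sup_le inf_le_right hBA)
  rw [hinf, finrank_bot] at h1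
  omega

lemma IsMSRD.minDist_pos {C : Code F m n} (hC : IsMSRD C) : 0 < minDist C := by
  obtain ⟨j, δ, -, hd, -⟩ := hC
  omega

lemma IsMSRD.minDist_le {C : Code F m n} (hC : IsMSRD C) : minDist C ≤ ∑ i, n i := by
  obtain ⟨j, δ, hδ, hd, -⟩ := hC
  have h1 := sum_Iio_add_self n j
  have h2 : ∑ i ∈ Finset.Iic j, n i ≤ ∑ i, n i :=
    Finset.sum_le_sum_of_subset (Finset.subset_univ _)
  omega

lemma IsMSRD.finrank_add_fillDim {C : Code F m n} (hC : IsMSRD C) :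
    finrank F C + fillDim m n (minDist C - 1) = fillDim m n (∑ i, n i) := by
  obtain ⟨j, δ, hδ, hd, hdim⟩ := hC
  have := sum_Ici_add_fillDim m n hδ
  rw [hd, Nat.add_sub_cancel, fillDim_sum]
  omega

lemma IsMSRD.genWeight_eq [Finite F] (hanti : Antitone m) (hm : ∀ i, 0 < m i)
    (hnm : ∀ i, n i ≤ m i) {C : Code F m n} (hC : IsMSRD C) {h s : ℕ} (hh : h ≤ ∑ i, n i)
    (hs : 0 < s) (hlow : fillDim m n (h - 1) < s + fillDim m n (minDist C - 1))
    (hupp : s + fillDim m n (minDist C - 1) ≤ fillDim m n h) : genWeight s C = h := by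
  have hmem : h ∈ {w | ∃ A : Code F m n,
      IsProductAnticode A ∧ s ≤ finrank F (C ⊓ A : Code F m n) ∧ maxSrk A = w} := by
    obtain ⟨A, hA, hdim, hmax⟩ := exists_isProductAnticode_fillDim (F := F) hm hnm hh
    refine ⟨A, hA, ?_, hmax⟩
    have h1 := Submodule.finrank_sup_add_finrank_inf_eq C A
    have h2 : finrank F (C ⊔ A : Code F m n) ≤ ∑ i, m i * n i := by
      refine (Submodule.finrank_le _).trans ?_
      simp [Module.finrank_pi_fintype, Module.finrank_matrix]
    have h3 := hC.finrank_add_fillDim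
    rw [fillDim_sum] at h3
    omega
  refine le_antisymm (Nat.sInf_le hmem) (le_csInf ⟨h, hmem⟩ ?_)
  rintro _ ⟨A, hA, hsA, rfl⟩
  by_contra! hlt
  have h1 := finrank_inf_add_fillDim_le hanti hm hnm C hC.minDist_pos hA
  rcases le_total (minDist C - 1) (maxSrk A) with hle | hle
  · rw [min_eq_left hle] at h1
    have := fillDim_mono m n (show maxSrk A ≤ h - 1 by omega)
    omega
  · rw [min_eq_right hle] at h1
    omega

end Products
end SumRank

theorem mainTheorem3 {F : Type*} [Field F] [Finite F] {ℓ : ℕ} (m n : Fin ℓ → ℕ)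
    (hm : Antitone m) (hn : ∀ i, 0 < n i) (hnm : ∀ i, n i ≤ m i)
    (C : SumRank.Code F m n) (hC : SumRank.IsMSRD C) :
    (∀ (h : ℕ) (k : Fin ℓ), SumRank.minDist C ≤ h → h ≤ ∑ i, n i → SumRank.IsBlockOf n h k →
      ∃ r : ℕ,
        (r : ℤ) = (SumRank.maxAnticodeDim F m n h : ℤ)
          - (SumRank.maxAnticodeDim F m n (SumRank.minDist C - 1) : ℤ) - (m k : ℤ) + 1 ∧
        1 ≤ r ∧ r + m k - 1 ≤ Module.finrank F C ∧
        ∀ s : ℕ, r ≤ s → s ≤ r + m k - 1 → SumRank.genWeight s C = h) ∧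
    (∀ s : ℕ, 1 ≤ s → s ≤ Module.finrank F C →
      ∃ (h : ℕ) (k : Fin ℓ) (r : ℕ),
        SumRank.minDist C ≤ h ∧ h ≤ ∑ i, n i ∧ SumRank.IsBlockOf n h k ∧
        (r : ℤ) = (SumRank.maxAnticodeDim F m n h : ℤ)
          - (SumRank.maxAnticodeDim F m n (SumRank.minDist C - 1) : ℤ) - (m k : ℤ) + 1 ∧
        r ≤ s ∧ s ≤ r + m k - 1) := by
  have hmpos : ∀ i, 0 < m i := fun i => (hn i).trans_le (hnm i)
  have hd := hC.minDist_pos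
  have hdn := hC.minDist_le
  have hdim := hC.finrank_add_fillDim
  have hmax : ∀ h ≤ ∑ i, n i, SumRank.maxAnticodeDim F m n h = SumRank.fillDim m n h :=
    fun h hh => SumRank.maxAnticodeDim_eq hm hmpos hnm hh
  have hmono := SumRank.fillDim_mono m n
  have hstep : ∀ h k, SumRank.minDist C ≤ h → h ≤ ∑ i, n i → SumRank.IsBlockOf n h k →
      SumRank.fillDim m n h = SumRank.fillDim m n (h - 1) + m k := by
    intro h k hdh hh hk
    obtain ⟨h, rfl⟩ := Nat.exists_eq_add_of_le' (hd.trans_le hdh)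
    exact SumRank.fillDim_succ m hk hh
  refine ⟨fun h k hdh hh hk => ?_, fun s hs1 hs => ?_⟩
  · have h1 := hstep h k hdh hh hk
    have h2 := hmono (show SumRank.minDist C - 1 ≤ h - 1 by omega)
    have h3 := hmono hh
    refine ⟨SumRank.fillDim m n (h - 1) - SumRank.fillDim m n (SumRank.minDist C - 1) + 1,
      ?_, by omega, by omega, fun s hrs hsr => ?_⟩
    · rw [hmax h hh, hmax _ (by omega)]
      omega
    · exact hC.genWeight_eq hm hmpos hnm hh (by omega) (by omega) (by omega)
  · -- `h` is the least number of columns whose entries leave room for `s` dimensions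
    have hex : ∃ h, s + SumRank.fillDim m n (SumRank.minDist C - 1) ≤ SumRank.fillDim m n h :=
      ⟨∑ i, n i, by omega⟩
    classical
    set h := Nat.find hex with hh
    have hspec : s + SumRank.fillDim m n (SumRank.minDist C - 1) ≤ SumRank.fillDim m n h :=
      Nat.find_spec hex
    have hhn : h ≤ ∑ i, n i := Nat.find_min' hex (by omega)
    have hdh : SumRank.minDist C ≤ h := by
      by_contra! hlt
      have := hmono (show h ≤ SumRank.minDist C - 1 by omega)
      omega
    have hmin := Nat.find_min hex (show h - 1 < h by omega)
    obtain ⟨k, hk⟩ := SumRank.exists_isBlockOf (hd.trans_le hdh) hhn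
    have h1 := hstep h k hdh hhn hk
    have h2 := hmono (show SumRank.minDist C - 1 ≤ h - 1 by omega)
    refine ⟨h, k,
      SumRank.fillDim m n (h - 1) - SumRank.fillDim m n (SumRank.minDist C - 1) + 1,
      hdh, hhn, hk, ?_, by omega, by omega⟩
    rw [hmax h hhn, hmax _ (by omega)]
    omega
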